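/- Let $\mathcal N=\{1,\dots,n\}$ be a finite set of products, let $\mathcal S$ be a collection of non-empty subsets (assortments) of $\mathcal N$, and let $\mathcal G$ be a partition (grouping) of $\mathcal N$. For $S\in\mathcal S$ let $\Delta_S=\{(x_{i})_{i\in S}: x_{i}\ge 0,\ \sum_{i\in S}x_{i}=1\}$. A choice probability collection is a point $\boldsymbol p=(p_{i,S}: S\in\mathcal S,\ i\in S)$ of $\prod_{S\in\mathcal S}\Delta_S$, and $\mu$ denotes the Lebesgue measure on $\prod_{S\in\mathcal S}\Delta_S$ (of dimension $\sum_{S\in\mathcal S}(|S|-1)$). Let $\mathcal P_{\mathcal G}(\mathcal S)$ be the set of the choice probability collections $\boldsymbol p$ for which there are $\lambda:\mathcal S\to\mathbb R$ and $\boldsymbol\nu\in\mathbb R^n$ such that, for all $S,T\in\mathcal S$, $i\in S$, $j\in T$ with $i$ and $j$ in the same group of $\mathcal G$, $$\lambda(S)-\nu_i>\lambda(T)-\nu_j\ \text{ if } p_{i,S}<p_{j,T},\qquad \lambda(S)-\nu_i=\lambda(T)-\nu_j\ \text{ if } p_{i,S}=p_{j,T}\neq 0 .$$ Let $\mathcal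 P_{\mathrm{APU}}(\mathcal S)$ be the set obtained when these conditions are required for all $S,T\in\mathcal S$, $i\in S$, $j\in T$ (all products in one group). Then $$\mu\big(\mathcal P_{\mathcal G}(\mathcal S)\big)\ \ge\ \mu\big(\mathcal P_{\mathrm{APU}}(\mathcal S)\big)\ >\ 0 .$$ The same holds for the choice probabilities represented by the models themselves. The marginal distribution model with marginals $F_1,\dots,F_n$ (absolutely continuous laws on $\mathbb R$ with finite mean and with a distribution function that is strictly increasing on the support) and deterministic utilities $\boldsymbol\nu\in\mathbb R^n$ yields $\boldsymbol p$ if for every $S\in\mathcal S$ there is a joint law $\theta^*$ with marginals $F_1,\dots,F_n$ that maximizes $\mathbb E_\theta[\max_{i\in S}(\nu_i+\tilde\epsilon_i)]$ over all joint laws $\theta$ of $(\tilde\epsilon_1,\dots,\tilde\epsilon_n)$ with these marginals, and $p_{i,S}=\mathbb P_{\theta^*}(i=\arg\max_{j\in S}(\nu_j+\tilde\epsilon_j))$ for all $i\in S$, where $i=\arg\max$ means that $i$ is the only maximizer. Let $\mathcal R_{\mathcal G}(\mathcal S)$ be the set of the choice probability collections yielded by such a model with $F_i=F_j$ whenever $i$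 and $j$ are in the same group of $\mathcal G$, and $\mathcal R_{\mathrm{APU}}(\mathcal S)$ the set of those yielded by such a model with all marginals identical. Then $$\mu\big(\mathcal R_{\mathcal G}(\mathcal S)\big)\ \ge\ \mu\big(\mathcal R_{\mathrm{APU}}(\mathcal S)\big)\ >\ 0 .$$ (For a set that is not known to be measurable, $\mu$ is the outer measure.) -/

import Mathlib

open MeasureTheory ProbabilityTheory

namespace ChoiceModel

/-- The product-assortment pairs of a collection `𝒮` of assortments of the products
`Fin n`: an assortment `S ∈ 𝒮` together with a product `i ∈ S`. -/
abbrev Pairs {n : ℕ} (𝒮 : Finset (Finset (Fin n))) : Type :=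
  Σ S : 𝒮, {i : Fin n // i ∈ S.1}

/-- Vectors `(p_{i,S} : i ∈ S, S ∈ 𝒮)` of real numbers, with the Euclidean norm. -/
abbrev Data {n : ℕ} (𝒮 : Finset (Finset (Fin n))) : Type :=
  EuclideanSpace ℝ (Pairs 𝒮)

/-- The product of the probability simplexes `Δ_S`, `S ∈ 𝒮`: the choice probability
collections. -/
def simplexes {n : ℕ} (𝒮 : Finset (Finset (Fin n))) : Set (Data 𝒮) :=
  {p | (∀ x, 0 ≤ p x) ∧ ∀ S : 𝒮, ∑ i : {i : Fin n // i ∈ S.1}, p ⟨S, i⟩ = 1}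

/-! ### Lebesgue measure on the product of the simplexes -/

/-- The linear subspace of directions of the affine hull of the product of the simplexes. -/
def directions {n : ℕ} (𝒮 : Finset (Finset (Fin n))) : Submodule ℝ (Data 𝒮) where
  carrier := {v | ∀ S : 𝒮, ∑ i : {i : Fin n // i ∈ S.1}, v ⟨S, i⟩ = 0}
  add_mem' := by
    intro v w hv hw S
    have h1 := hv S
    have h2 := hw S
    simp only [PiLp.add_apply, Finset.sum_add_distrib]
    rw [h1, h2, add_zero]
  zero_mem' := by
    intro S
    simp
  smul_mem' := by
    intro c v hv S
    have h1 := hv S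
    simp only [PiLp.smul_apply, smul_eq_mul, ← Finset.mul_sum]
    rw [h1, mul_zero]

/-- The collection of the uniform distributions on the assortments, a point of the product of the
simplexes when all assortments are non-empty. -/
noncomputable def barycenter {n : ℕ} (𝒮 : Finset (Finset (Fin n))) : Data 𝒮 :=
  WithLp.toLp 2 fun x => ((x.1.1.card : ℝ))⁻¹

/-- Lebesgue measure on the product of the simplexes (each `Δ_S` being a convex body of dimension
`|S| - 1` in its affine hull): the Lebesgue measure of the Euclidean space of directions, moved to
the affine hull of the product and restricted to the product. -/
noncomputable def lebesgue {n : ℕ} (𝒮 : Finset (Finset (Fin n))) : Measure (Data 𝒮) :=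
  (Measure.map (fun v : directions 𝒮 => barycenter 𝒮 + (v : Data 𝒮))
    (stdOrthonormalBasis ℝ (directions 𝒮)).toBasis.addHaar).restrict (simplexes 𝒮)

/-! ### The order conditions -/

/-- The conditions on a choice probability collection `p` with disutilities `lam` of the assortments
and deterministic utilities `ν`, for all pairs `(i, S)`, `(j, T)` whose products are related
by `R`. -/
def OrderConditions {n : ℕ} {𝒮 : Finset (Finset (Fin n))} (R : Fin n → Fin n → Prop)
    (p : Data 𝒮) (lam : 𝒮 → ℝ) (ν : Fin n → ℝ) : Prop :=
  ∀ x y : Pairs 𝒮, R x.2 y.2 →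
    (p x < p y → lam x.1 - ν x.2 > lam y.1 - ν y.2) ∧
    (p x = p y → p x ≠ 0 → lam x.1 - ν x.2 = lam y.1 - ν y.2)

/-- `P_𝒢(𝒮)`: the choice probability collections satisfying the conditions for a grouped marginal
distribution model with the grouping `𝒢` of the products. -/
def groupedSet {n : ℕ} (𝒢 : Finpartition (Finset.univ : Finset (Fin n)))
    (𝒮 : Finset (Finset (Fin n))) : Set (Data 𝒮) :=
  {p | p ∈ simplexes 𝒮 ∧ ∃ (lam : 𝒮 → ℝ) (ν : Fin n → ℝ),
    OrderConditions (fun i j => 𝒢.part i = 𝒢.part j) p lam ν}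

/-- `P_APU(𝒮)`: the choice probability collections satisfying the conditions for all pairs. -/
def apuSet {n : ℕ} (𝒮 : Finset (Finset (Fin n))) : Set (Data 𝒮) :=
  {p | p ∈ simplexes 𝒮 ∧ ∃ (lam : 𝒮 → ℝ) (ν : Fin n → ℝ),
    OrderConditions (fun _ _ => True) p lam ν}

/-! ### The marginal distribution model -/

/-- The admissible marginals: absolutely continuous laws on `ℝ` with finite mean and a distribution
function that is strictly increasing on the support. -/
structure IsMarginal (F : Measure ℝ) : Prop where
  isProbabilityMeasure : IsProbabilityMeasure F
  absolutelyContinuous : F ≪ volume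
  strictMonoOn_cdf : StrictMonoOn (cdf F) F.support
  integrable : Integrable (fun t => t) F

/-- The joint laws of `(ε_1, …, ε_n)` with marginals `F_1, …, F_n`. -/
def jointLaws {n : ℕ} (F : Fin n → Measure ℝ) : Set (Measure (Fin n → ℝ)) :=
  {θ | IsProbabilityMeasure θ ∧ ∀ i, θ.map (fun ε => ε i) = F i}

/-- The expected utility `E_θ[max_{i ∈ S} (ν_i + ε_i)]` of a consumer offered `S ≠ ∅`. -/
noncomputable def expectedUtility {n : ℕ} (ν : Fin n → ℝ) (S : Finset (Fin n))
    (θ : Measure (Fin n → ℝ)) : ℝ :=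
  ∫ ε, (⨆ i : {i : Fin n // i ∈ S}, (ν i + ε i)) ∂θ

/-- The probability `P_θ(i = argmax_{j ∈ S} (ν_j + ε_j))`. -/
noncomputable def choiceProb {n : ℕ} (ν : Fin n → ℝ) (S : Finset (Fin n))
    (θ : Measure (Fin n → ℝ)) (i : Fin n) : ℝ :=
  θ.real {ε | ∀ j ∈ S, j ≠ i → ν j + ε j < ν i + ε i}

/-- The marginal distribution model with marginals `F` and deterministic utilities `ν` yields the
choice probabilities `p`: for each assortment, they are the choice probabilities of a joint law that
maximizes the expected utility over all joint laws with the marginals `F`. -/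
def Yields {n : ℕ} {𝒮 : Finset (Finset (Fin n))} (F : Fin n → Measure ℝ) (ν : Fin n → ℝ)
    (p : Data 𝒮) : Prop :=
  ∀ S : 𝒮, ∃ θ ∈ jointLaws F, IsMaxOn (expectedUtility ν S.1) (jointLaws F) θ ∧
    ∀ i : {i : Fin n // i ∈ S.1}, choiceProb ν S.1 θ i = p ⟨S, i⟩

/-- The choice probability collections represented by a grouped marginal distribution model:
products of the same group of `𝒢` have the same marginal. -/
def groupedRepresentable {n : ℕ} (𝒢 : Finpartition (Finset.univ : Finset (Fin n)))
    (𝒮 : Finset (Finset (Fin n))) : Set (Data 𝒮) :=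
  {p | p ∈ simplexes 𝒮 ∧ ∃ (F : Fin n → Measure ℝ) (ν : Fin n → ℝ),
    (∀ i, IsMarginal (F i)) ∧ (∀ i j, 𝒢.part i = 𝒢.part j → F i = F j) ∧ Yields F ν p}

/-- The choice probability collections represented by a marginal distribution model with identical
marginals. -/
def apuRepresentable {n : ℕ} (𝒮 : Finset (Finset (Fin n))) : Set (Data 𝒮) :=
  {p | p ∈ simplexes 𝒮 ∧ ∃ (F : Measure ℝ) (ν : Fin n → ℝ),
    IsMarginal F ∧ Yields (fun _ => F) ν p}

end ChoiceModel

/-! Both inequalities are inclusions: conditions imposed on all pairs hold within groups, and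
identical marginals respect every grouping. For positivity it suffices that both APU sets contain
all positive collections near one positive collection, since these have positive measure
(`lebesgue_pos_of_ball`). The centre `p` is a small generic affine perturbation of the uniform
distributions, `p x = 1/|S| + s (w i - mean of w over S)`, so `1 - p x` has the form `lam S - ν i`.
For generic `w` its entries are distinct, apart from those of singletons, which equal `1` in every
collection (`exists_generic`). For `q` near `p`, an increasing Lipschitz bijection `ψ` of the line
then sends each `1 - p x` to `1 - q x` (`exists_thresholds`). With `lam` and `ν` fixed, monotonicity
of `ψ` gives the order conditions for `q`. The law with distribution function `ψ`, cut off to values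
in `[0, 1]`, exceeds `lam S - ν i` with probability `q x`. A coupling in which exactly one product
of `S` exceeds its threshold attains the dual bound for the expected utility, so the model yields
`q` (`yields_of_thresholds`). -/

namespace ChoiceModel

variable {n : ℕ}

/-! ### Laws with a prescribed quantile function -/

/-- The law of `ψ⁻¹ U` with `U` uniformly distributed on the unit interval. -/
noncomputable def quantileLaw (ψ : ℝ ≃o ℝ) : Measure ℝ :=
  (volume.restrict (Set.Icc (0 : ℝ) 1)).map ψ.symm

lemma quantileLaw_apply (ψ : ℝ ≃o ℝ) {A : Set ℝ} (hA : MeasurableSet A) :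
    quantileLaw ψ A = volume (ψ.symm ⁻¹' A ∩ Set.Icc 0 1) := by
  have hm : Measurable ψ.symm := ψ.symm.continuous.measurable
  rw [quantileLaw, Measure.map_apply hm hA, Measure.restrict_apply (hm hA)]

instance isProbabilityMeasure_quantileLaw (ψ : ℝ ≃o ℝ) :
    IsProbabilityMeasure (quantileLaw ψ) :=
  ⟨by simp [quantileLaw_apply ψ MeasurableSet.univ]⟩

lemma quantileLaw_real_Ioi (ψ : ℝ ≃o ℝ) {a : ℝ} (h0 : 0 ≤ ψ a) (h1 : ψ a ≤ 1) :
    (quantileLaw ψ).real (Set.Ioi a) = 1 - ψ a := by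
  have h : ψ.symm ⁻¹' Set.Ioi a ∩ Set.Icc 0 1 = Set.Ioc (ψ a) 1 := by
    ext u
    simp only [Set.mem_inter_iff, Set.mem_preimage, Set.mem_Ioi, Set.mem_Icc, Set.mem_Ioc,
      OrderIso.lt_symm_apply]
    exact ⟨fun h => ⟨h.1, h.2.2⟩, fun h => ⟨h.1, h0.trans h.1.le, h.2⟩⟩
  rw [measureReal_def, quantileLaw_apply ψ measurableSet_Ioi, h, Real.volume_Ioc,
    ENNReal.toReal_ofReal (by linarith)]

lemma quantileLaw_real_Iic (ψ : ℝ ≃o ℝ) {a : ℝ} (h0 : 0 ≤ ψ a) (h1 : ψ a ≤ 1) :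
    (quantileLaw ψ).real (Set.Iic a) = ψ a := by
  rw [← Set.compl_Ioi, probReal_compl_eq_one_sub measurableSet_Ioi,
    quantileLaw_real_Ioi ψ h0 h1, sub_sub_cancel]

lemma ae_quantileLaw_mem_Icc (ψ : ℝ ≃o ℝ) :
    ∀ᵐ t ∂quantileLaw ψ, t ∈ Set.Icc (ψ.symm 0) (ψ.symm 1) := by
  rw [ae_iff]
  change quantileLaw ψ (Set.Icc (ψ.symm 0) (ψ.symm 1))ᶜ = 0
  rw [quantileLaw_apply ψ measurableSet_Icc.compl]
  convert measure_empty (μ := volume)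
  ext u
  simp only [Set.mem_inter_iff, Set.mem_preimage, Set.mem_compl_iff, Set.mem_Icc,
    OrderIso.le_iff_le, Set.mem_empty_iff_false]
  tauto

/-- A Lipschitz `ψ` maps null sets to null sets, which gives absolute continuity. The law lives on
the compact interval where `ψ` takes values in `[0, 1]`, and there its distribution function is `ψ`.
-/
lemma isMarginal_quantileLaw (ψ : ℝ ≃o ℝ) {K : NNReal} (hψ : LipschitzWith K ψ) :
    IsMarginal (quantileLaw ψ) where
  isProbabilityMeasure := inferInstance
  absolutelyContinuous := by
    refine Measure.AbsolutelyContinuous.mk fun A hA hA0 => ?_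
    rw [quantileLaw_apply ψ hA]
    refine measure_mono_null Set.inter_subset_left ?_
    have h : ψ.symm ⁻¹' A = ψ '' A := by
      ext u
      exact ⟨fun h => ⟨_, h, ψ.apply_symm_apply u⟩, by rintro ⟨t, ht, rfl⟩; simpa using ht⟩
    have hle := hψ.hausdorffMeasure_image_le zero_le_one A
    rw [hausdorffMeasure_real, hA0, mul_zero] at hle
    rw [h]
    exact le_antisymm hle zero_le
  strictMonoOn_cdf := by
    have hs : (quantileLaw ψ).support ⊆ Set.Icc (ψ.symm 0) (ψ.symm 1) :=
      Measure.support_subset_of_isClosed isClosed_Icc (ae_quantileLaw_mem_Icc ψ)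
    have hc : ∀ t ∈ Set.Icc (ψ.symm 0) (ψ.symm 1), cdf (quantileLaw ψ) t = ψ t := by
      intro t ht
      rw [cdf_eq_real]
      exact quantileLaw_real_Iic ψ (ψ.symm_apply_le.1 ht.1) (ψ.le_symm_apply.1 ht.2)
    intro s hs' t ht' hst
    rw [hc s (hs hs'), hc t (hs ht')]
    exact ψ.strictMono hst
  integrable := by
    refine Integrable.of_mem_Icc (ψ.symm 0) (ψ.symm 1) measurable_id.aemeasurable ?_
    exact ae_quantileLaw_mem_Icc ψ

/-! ### Perturbations of the identity -/

/-- An increasing bi-Lipschitz map of the line that moves finitely many separated points by small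
prescribed amounts. -/
lemma exists_orderIso_apply_eq_sub {X : Type*} [Fintype X] (a d : X → ℝ) {δ : ℝ} (hδ : 0 < δ)
    (hsep : ∀ x y, x ≠ y → d y = 0 ∨ δ ≤ |a x - a y|) (hd : ∑ x, |d x| ≤ δ / 2) :
    ∃ ψ : ℝ ≃o ℝ, (∃ K, LipschitzWith K ψ) ∧ ∀ x, ψ (a x) = a x - d x := by
  classical
  -- A sum of tents of height `d x` and half-width `δ` centred at `a x`. The bound on `∑ |d x|`
  -- makes it `1/2`-Lipschitz, so `t - g t` increases with slope at least `1/2`.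
  set g : ℝ → ℝ := fun t => ∑ x, d x * max 0 (1 - |t - a x| / δ) with hg
  have hlip : ∀ s t, |g s - g t| ≤ |s - t| / 2 := by
    intro s t
    have hx : ∀ x, |max 0 (1 - |s - a x| / δ) - max 0 (1 - |t - a x| / δ)| ≤ |s - t| / δ := by
      intro x
      refine (abs_max_sub_max_le_max _ _ _ _).trans ?_
      rw [sub_self, abs_zero, max_eq_right (abs_nonneg _),
        show 1 - |s - a x| / δ - (1 - |t - a x| / δ) = (|t - a x| - |s - a x|) / δ by ring,
        abs_div, abs_of_pos hδ]
      refine div_le_div_of_nonneg_right ?_ hδ.le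
      refine (abs_abs_sub_abs_le (t - a x) (s - a x)).trans ?_
      rw [sub_sub_sub_cancel_right, abs_sub_comm]
    calc |g s - g t|
        = |∑ x, d x * (max 0 (1 - |s - a x| / δ) - max 0 (1 - |t - a x| / δ))| := by
          simp only [hg, mul_sub, Finset.sum_sub_distrib]
      _ ≤ ∑ x, |d x| * (|s - t| / δ) := by
          refine (Finset.abs_sum_le_sum_abs _ _).trans (Finset.sum_le_sum fun x _ => ?_)
          rw [abs_mul]
          exact mul_le_mul_of_nonneg_left (hx x) (abs_nonneg _)
      _ = (∑ x, |d x|) * (|s - t| / δ) := (Finset.sum_mul ..).symm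
      _ ≤ δ / 2 * (|s - t| / δ) := by gcongr
      _ = |s - t| / 2 := by field_simp
  have hL : LipschitzWith 2 (fun t => t - g t) := by
    refine LipschitzWith.of_dist_le_mul fun s t => ?_
    rw [Real.dist_eq, Real.dist_eq, show s - g s - (t - g t) = (s - t) - (g s - g t) by ring]
    have h1 := abs_sub (s - t) (g s - g t)
    have h2 := hlip s t
    have h3 := abs_nonneg (s - t)
    norm_num
    linarith
  have hmono : StrictMono (fun t => t - g t) := by
    intro s t hst
    have h1 := (abs_le.1 (hlip t s)).2
    rw [abs_of_pos (sub_pos.2 hst)] at h1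
    simp only
    linarith
  have hsurj : Function.Surjective (fun t => t - g t) := by
    refine hL.continuous.surjective ?_ ?_
    · refine Filter.tendsto_atTop_mono' _ (f₁ := fun t => t / 2 - g 0) ?_ ?_
      · filter_upwards [Filter.eventually_ge_atTop 0] with t ht
        have h1 := (abs_le.1 (hlip t 0)).2
        rw [sub_zero, abs_of_nonneg ht] at h1
        linarith
      · exact Filter.tendsto_atTop_add_const_right _ _
          (Filter.tendsto_id.atTop_div_const two_pos)
    · refine Filter.tendsto_atBot_mono' _ (f₁ := fun t => t / 2 - g 0) ?_ ?_
      · filter_upwards [Filter.eventually_le_atBot 0] with t ht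
        have h1 := (abs_le.1 (hlip t 0)).1
        rw [sub_zero, abs_of_nonpos ht] at h1
        linarith
      · exact Filter.tendsto_atBot_add_const_right _ _
          (Filter.tendsto_id.atBot_div_const two_pos)
  refine ⟨hmono.orderIsoOfSurjective _ hsurj, ⟨2, hL⟩, fun x => ?_⟩
  change a x - g (a x) = a x - d x
  rw [hg]
  simp only
  rw [Finset.sum_eq_single x]
  · simp
  -- The tent at `a y` does not affect `a x`: it has height zero, or `a x` lies outside it.
  · intro y _ hy
    rcases hsep x y hy.symm with h | h
    · rw [h, zero_mul]
    · rw [max_eq_left, mul_zero]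
      rw [sub_nonpos, one_le_div hδ]
      exact h
  · simp

/-! ### The dual bound for the expected utility -/

lemma le_iSup_utility (ν ε : Fin n → ℝ) {S : Finset (Fin n)} {i : Fin n} (hi : i ∈ S) :
    ν i + ε i ≤ ⨆ j : {j : Fin n // j ∈ S}, (ν j + ε j) :=
  le_ciSup (f := fun j : {j : Fin n // j ∈ S} => ν j + ε j) (Finite.bddAbove_range _) ⟨i, hi⟩

lemma integrable_utility {F : Fin n → Measure ℝ} (hF : ∀ i, IsMarginal (F i)) (ν : Fin n → ℝ)
    {θ : Measure (Fin n → ℝ)} (hθ : θ ∈ jointLaws F) (i : Fin n) :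
    Integrable (fun ε : Fin n → ℝ => ν i + ε i) θ := by
  have := hθ.1
  refine (integrable_const _).add ?_
  have h := (hF i).integrable
  rw [← hθ.2 i] at h
  exact h.comp_measurable (measurable_pi_apply i)

lemma integrable_iSup_utility {F : Fin n → Measure ℝ} (hF : ∀ i, IsMarginal (F i))
    (ν : Fin n → ℝ) {S : Finset (Fin n)} (hS : S.Nonempty) {θ : Measure (Fin n → ℝ)}
    (hθ : θ ∈ jointLaws F) :
    Integrable (fun ε : Fin n → ℝ => ⨆ i : {i : Fin n // i ∈ S}, (ν i + ε i)) θ := by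
  have hne : Nonempty {i : Fin n // i ∈ S} := hS.to_subtype
  have hdom : Integrable (fun ε : Fin n → ℝ => ∑ i ∈ S, |ν i + ε i|) θ :=
    integrable_finsetSum _ fun i _ => (integrable_utility hF ν hθ i).abs
  refine hdom.mono' ?_ (Filter.Eventually.of_forall fun ε => ?_)
  · exact (Measurable.iSup fun i => (measurable_pi_apply i.1).const_add _).aestronglyMeasurable
  · have hle : ∀ i ∈ S, |ν i + ε i| ≤ ∑ i ∈ S, |ν i + ε i| := fun i hi =>
      Finset.single_le_sum (f := fun i => |ν i + ε i|) (fun _ _ => abs_nonneg _) hi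
    rw [Real.norm_eq_abs, abs_le]
    constructor
    · obtain ⟨i, hi⟩ := hS
      exact (neg_le_neg (hle i hi)).trans ((neg_abs_le _).trans (le_iSup_utility ν ε hi))
    · exact ciSup_le fun i => (le_abs_self _).trans (hle i i.2)

/-- Every joint law under which exactly one utility exceeds the level `l` maximizes the expected
utility. -/
lemma isMaxOn_expectedUtility {F : Fin n → Measure ℝ} (hF : ∀ i, IsMarginal (F i))
    (ν : Fin n → ℝ) {S : Finset (Fin n)} (hS : S.Nonempty) (l : ℝ) {θ : Measure (Fin n → ℝ)}
    (hθ : θ ∈ jointLaws F)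
    (hae : ∀ᵐ ε ∂θ, ∃ i ∈ S, l < ν i + ε i ∧ ∀ j ∈ S, j ≠ i → ν j + ε j ≤ l) :
    IsMaxOn (expectedUtility ν S) (jointLaws F) θ := by
  have hne : Nonempty {i : Fin n // i ∈ S} := hS.to_subtype
  have hterm : ∀ θ' ∈ jointLaws F, ∀ i,
      Integrable (fun ε : Fin n → ℝ => max 0 (ν i + ε i - l)) θ' := fun θ' hθ' i => by
    have := hθ'.1
    exact (integrable_zero _ _ _).sup ((integrable_utility hF ν hθ' i).sub (integrable_const l))
  have hint : ∀ θ' ∈ jointLaws F,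
      Integrable (fun ε : Fin n → ℝ => l + ∑ i ∈ S, max 0 (ν i + ε i - l)) θ' :=
      fun θ' hθ' => by
    have := hθ'.1
    exact (integrable_const l).add (integrable_finsetSum _ fun i _ => hterm θ' hθ' i)
  -- This expectation depends on the marginals only, hence is an upper bound common to all joint
  -- laws.
  have hval : ∀ θ' ∈ jointLaws F,
      ∫ ε, (l + ∑ i ∈ S, max 0 (ν i + ε i - l)) ∂θ' =
        l + ∑ i ∈ S, ∫ t, max 0 (ν i + t - l) ∂F i := fun θ' hθ' => by
    have := hθ'.1
    rw [integral_add (integrable_const l) (integrable_finsetSum _ fun i _ => hterm θ' hθ' i),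
      integral_finsetSum _ fun i _ => hterm θ' hθ' i]
    congr 1
    · simp
    · refine Finset.sum_congr rfl fun i _ => ?_
      rw [← hθ'.2 i, integral_map (measurable_pi_apply i).aemeasurable]
      exact Continuous.aestronglyMeasurable (by fun_prop)
  intro θ' hθ'
  change expectedUtility ν S θ' ≤ expectedUtility ν S θ
  have hle : expectedUtility ν S θ' ≤ l + ∑ i ∈ S, ∫ t, max 0 (ν i + t - l) ∂F i := by
    rw [← hval θ' hθ']
    refine integral_mono (integrable_iSup_utility hF ν hS hθ') (hint θ' hθ') fun ε => ?_
    refine ciSup_le fun i => ?_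
    have h := Finset.single_le_sum (f := fun i => max 0 (ν i + ε i - l))
      (fun _ _ => le_max_left _ _) i.2
    have h' := le_max_right 0 (ν i + ε i - l)
    simp only at h ⊢
    linarith
  refine hle.trans_eq ?_
  rw [← hval θ hθ]
  -- The pointwise bound `max ≤ l + ∑ (utility - l)⁺` is an equality when exactly one utility
  -- exceeds `l`.
  refine integral_congr_ae ?_
  filter_upwards [hae] with ε hε
  obtain ⟨i, hi, hil, hj⟩ := hε
  rw [Finset.sum_eq_single_of_mem i hi, max_eq_right (by linarith), add_sub_cancel]
  · refine le_antisymm (le_iSup_utility ν ε hi) (ciSup_le fun j => ?_)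
    by_cases hji : j.1 = i
    · rw [hji]
    · exact (hj j j.2 hji).trans hil.le
  · intro j hjS hji
    exact max_eq_left (by linarith [hj j hjS hji])

/-! ### The optimal coupling -/

/-- The law of the utility noise of product `j` given that product `i` is chosen from `S`, when a
product is chosen if its noise exceeds its threshold `t`. -/
noncomputable def conditionalMarginal (F : Fin n → Measure ℝ) (t : Fin n → ℝ)
    (S : Finset (Fin n)) (i j : Fin n) : Measure ℝ :=
  if j = i then (F j)[|Set.Ioi (t j)] else if j ∈ S then (F j)[|Set.Iic (t j)] else F j

/-- The mixture of the products of the conditional marginals. -/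
noncomputable def thresholdCoupling (F : Fin n → Measure ℝ) (t : Fin n → ℝ)
    (S : Finset (Fin n)) : Measure (Fin n → ℝ) :=
  ∑ i ∈ S, F i (Set.Ioi (t i)) • Measure.pi (conditionalMarginal F t S i)

section Coupling

variable {F : Fin n → Measure ℝ} {t : Fin n → ℝ} {S : Finset (Fin n)}

/-- The components in which `j` is not chosen have exactly the total weight needed to rebuild the
part of `F j` below its threshold. -/
lemma sum_erase_eq_measure_Iic (hF : ∀ i, IsProbabilityMeasure (F i))
    (hsum : ∑ i ∈ S, F i (Set.Ioi (t i)) = 1) {j : Fin n} (hj : j ∈ S) :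
    ∑ i ∈ S.erase j, F i (Set.Ioi (t i)) = F j (Set.Iic (t j)) := by
  have h1 : F j (Set.Ioi (t j)) + F j (Set.Iic (t j)) = 1 := by
    have := prob_add_prob_compl (μ := F j) (measurableSet_Ioi (a := t j))
    rwa [Set.compl_Ioi] at this
  have h2 := Finset.add_sum_erase S (fun i => F i (Set.Ioi (t i))) hj
  rw [hsum] at h2
  exact (ENNReal.add_right_inj (measure_ne_top (F j) _)).1 (h2.trans h1.symm)

lemma isProbabilityMeasure_conditionalMarginal (hF : ∀ i, IsProbabilityMeasure (F i))
    (hsum : ∑ i ∈ S, F i (Set.Ioi (t i)) = 1) (hpos : ∀ i ∈ S, F i (Set.Ioi (t i)) ≠ 0)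
    {i : Fin n} (hi : i ∈ S) (j : Fin n) :
    IsProbabilityMeasure (conditionalMarginal F t S i j) := by
  unfold conditionalMarginal
  split_ifs with hji hj
  · exact cond_isProbabilityMeasure (hji ▸ hpos i hi)
  · refine cond_isProbabilityMeasure ?_
    -- The mass of `F j` below its threshold includes the positive weight of component `i ≠ j`.
    rw [← sum_erase_eq_measure_Iic hF hsum hj]
    intro h0
    exact hpos i hi (Finset.sum_eq_zero_iff.1 h0 i (Finset.mem_erase.2 ⟨Ne.symm hji, hi⟩))
  · exact hF j

lemma ae_pi_conditionalMarginal (hF : ∀ i, IsProbabilityMeasure (F i))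
    (hsum : ∑ i ∈ S, F i (Set.Ioi (t i)) = 1) (hpos : ∀ i ∈ S, F i (Set.Ioi (t i)) ≠ 0)
    {i : Fin n} (hi : i ∈ S) :
    ∀ᵐ ε ∂Measure.pi (conditionalMarginal F t S i),
      t i < ε i ∧ ∀ j ∈ S, j ≠ i → ε j ≤ t j := by
  have hprob := isProbabilityMeasure_conditionalMarginal hF hsum hpos hi
  have hev := fun j =>
    (measurePreserving_eval (conditionalMarginal F t S i) j).quasiMeasurePreserving
  refine Filter.Eventually.and ?_ ?_
  · refine (hev i).ae (p := fun s => t i < s) ?_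
    rw [conditionalMarginal, if_pos rfl]
    exact ae_cond_mem measurableSet_Ioi
  · rw [ae_all_iff]
    intro j
    by_cases hj : j ∈ S
    · by_cases hji : j = i
      · exact Filter.Eventually.of_forall fun _ _ h => absurd hji h
      · have : ∀ᵐ s ∂conditionalMarginal F t S i j, s ≤ t j := by
          rw [conditionalMarginal, if_neg hji, if_pos hj]
          exact ae_cond_mem measurableSet_Iic
        filter_upwards [(hev j).ae this] with ε hε _ _
        exact hε
    · exact Filter.Eventually.of_forall fun _ h => absurd h hj

/-- For `j ∈ S` this is total probability: component `j` contributes `F j` above the threshold, the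
others together contribute `F j` below it. For `j ∉ S` every component has marginal `F j`. -/
lemma thresholdCoupling_mem_jointLaws (hF : ∀ i, IsProbabilityMeasure (F i))
    (hsum : ∑ i ∈ S, F i (Set.Ioi (t i)) = 1) (hpos : ∀ i ∈ S, F i (Set.Ioi (t i)) ≠ 0) :
    thresholdCoupling F t S ∈ jointLaws F := by
  have hprob := fun i (hi : i ∈ S) => isProbabilityMeasure_conditionalMarginal hF hsum hpos hi
  refine ⟨⟨?_⟩, fun j => ?_⟩
  · rw [thresholdCoupling, Measure.finsetSum_apply, ← hsum]
    refine Finset.sum_congr rfl fun i hi => ?_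
    have := hprob i hi
    rw [Measure.smul_apply, measure_univ, smul_eq_mul, mul_one]
  · ext A hA
    have hsumA : (thresholdCoupling F t S).map (fun ε => ε j) A =
        ∑ i ∈ S, F i (Set.Ioi (t i)) * conditionalMarginal F t S i j A := by
      rw [Measure.map_apply (measurable_pi_apply j) hA, thresholdCoupling,
        Measure.finsetSum_apply]
      refine Finset.sum_congr rfl fun i hi => ?_
      have := hprob i hi
      rw [Measure.smul_apply, smul_eq_mul]
      congr 1
      exact (measurePreserving_eval (conditionalMarginal F t S i) j).measure_preimage
        hA.nullMeasurableSet
    rw [hsumA]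
    by_cases hj : j ∈ S
    · rw [← Finset.add_sum_erase _ _ hj, conditionalMarginal, if_pos rfl]
      have hrest : ∑ i ∈ S.erase j, F i (Set.Ioi (t i)) * conditionalMarginal F t S i j A =
          F j (Set.Iic (t j) ∩ A) := by
        rw [← cond_mul_eq_inter measurableSet_Iic, mul_comm,
          ← sum_erase_eq_measure_Iic hF hsum hj, Finset.sum_mul]
        refine Finset.sum_congr rfl fun i hi => ?_
        rw [conditionalMarginal, if_neg (Finset.ne_of_mem_erase hi).symm, if_pos hj]
      rw [hrest, mul_comm, cond_mul_eq_inter measurableSet_Ioi, ← Set.compl_Ioi,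
        Set.inter_comm, Set.inter_comm _ A, ← Set.sdiff_eq, measure_inter_add_sdiff _ measurableSet_Ioi]
    · rw [← one_mul (F j A), ← hsum, Finset.sum_mul]
      refine Finset.sum_congr rfl fun i hi => ?_
      rw [conditionalMarginal, if_neg (fun h : j = i => hj (h ▸ hi)), if_neg hj]

lemma ae_thresholdCoupling (hF : ∀ i, IsProbabilityMeasure (F i))
    (hsum : ∑ i ∈ S, F i (Set.Ioi (t i)) = 1) (hpos : ∀ i ∈ S, F i (Set.Ioi (t i)) ≠ 0) :
    ∀ᵐ ε ∂thresholdCoupling F t S, ∃ i ∈ S, t i < ε i ∧ ∀ j ∈ S, j ≠ i → ε j ≤ t j := by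
  rw [ae_iff, thresholdCoupling, Measure.finsetSum_apply]
  refine Finset.sum_eq_zero fun i hi => ?_
  rw [Measure.smul_apply, smul_eq_mul]
  refine mul_eq_zero_of_right _ (ae_iff.1 ?_)
  filter_upwards [ae_pi_conditionalMarginal hF hsum hpos hi] with ε hε
  exact ⟨i, hi, hε⟩

lemma choiceProb_thresholdCoupling (hF : ∀ i, IsProbabilityMeasure (F i))
    (hsum : ∑ i ∈ S, F i (Set.Ioi (t i)) = 1) (hpos : ∀ i ∈ S, F i (Set.Ioi (t i)) ≠ 0)
    (ν : Fin n → ℝ) {l : ℝ} (ht : ∀ i, t i = l - ν i) {i : Fin n} (hi : i ∈ S) :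
    choiceProb ν S (thresholdCoupling F t S) i = (F i).real (Set.Ioi (t i)) := by
  rw [choiceProb, measureReal_def, measureReal_def, thresholdCoupling, Measure.finsetSum_apply,
    Finset.sum_eq_single_of_mem i hi]
  · have := isProbabilityMeasure_conditionalMarginal hF hsum hpos hi
    have hone : ∀ᵐ ε ∂Measure.pi (conditionalMarginal F t S i),
        ∀ j ∈ S, j ≠ i → ν j + ε j < ν i + ε i := by
      filter_upwards [ae_pi_conditionalMarginal hF hsum hpos hi] with ε hε j hj hji
      have h1 := hε.1
      have h2 := hε.2 j hj hji
      rw [ht] at h1 h2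
      linarith
    rw [Measure.smul_apply, smul_eq_mul, measure_congr (Filter.eventuallyEq_univ.2 hone),
      measure_univ, mul_one]
  · intro k hk hki
    rw [Measure.smul_apply, smul_eq_mul]
    refine mul_eq_zero_of_right _ ?_
    have h : ∀ᵐ ε ∂Measure.pi (conditionalMarginal F t S k),
        ¬ ∀ j ∈ S, j ≠ i → ν j + ε j < ν i + ε i := by
      filter_upwards [ae_pi_conditionalMarginal hF hsum hpos hk] with ε hε h
      have h1 := h k hk hki
      have h2 := hε.1
      have h3 := hε.2 i hi hki.symm
      rw [ht] at h2 h3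
      linarith
    simpa [ae_iff] using h

end Coupling

/-- A marginal distribution model yields the choice probabilities given by thresholds that make
them sum to one on each assortment. -/
lemma yields_of_thresholds {𝒮 : Finset (Finset (Fin n))} (h𝒮 : ∀ S ∈ 𝒮, S.Nonempty)
    {F : Fin n → Measure ℝ} (hF : ∀ i, IsMarginal (F i)) (ν : Fin n → ℝ) (lam : 𝒮 → ℝ)
    {p : Data 𝒮} (hp : p ∈ simplexes 𝒮) (hpos : ∀ x, 0 < p x)
    (h : ∀ x : Pairs 𝒮, (F x.2).real (Set.Ioi (lam x.1 - ν x.2)) = p x) :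
    Yields F ν p := by
  intro S
  have hprob := fun i => (hF i).isProbabilityMeasure
  set t : Fin n → ℝ := fun i => lam S - ν i with ht
  have hval : ∀ i (hi : i ∈ S.1), F i (Set.Ioi (t i)) = ENNReal.ofReal (p ⟨S, i, hi⟩) :=
    fun i hi => by rw [← h ⟨S, i, hi⟩, ofReal_measureReal]
  have hne : ∀ i ∈ S.1, F i (Set.Ioi (t i)) ≠ 0 := fun i hi => by
    rw [hval i hi]
    exact (ENNReal.ofReal_pos.2 (hpos _)).ne'
  have hsum : ∑ i ∈ S.1, F i (Set.Ioi (t i)) = 1 := by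
    rw [← ENNReal.ofReal_one, ← hp.2 S, ENNReal.ofReal_sum_of_nonneg fun i _ => hp.1 _,
      ← Finset.sum_coe_sort]
    exact Finset.sum_congr rfl fun i _ => hval i i.2
  refine ⟨thresholdCoupling F t S, thresholdCoupling_mem_jointLaws hprob hsum hne, ?_, ?_⟩
  · refine isMaxOn_expectedUtility hF ν (h𝒮 S S.2) (lam S)
      (thresholdCoupling_mem_jointLaws hprob hsum hne) ?_
    filter_upwards [ae_thresholdCoupling hprob hsum hne] with ε hε
    obtain ⟨i, hi, h1, h2⟩ := hε
    refine ⟨i, hi, by linarith, fun j hj hji => ?_⟩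
    linarith [h2 j hj hji]
  · intro i
    rw [choiceProb_thresholdCoupling hprob hsum hne ν (fun _ => rfl) i.2]
    exact h ⟨S, i⟩

/-! ### A generic choice probability collection -/

/-- The excess of the utility of a product over the mean utility of the assortment. -/
noncomputable def relativeUtility {𝒮 : Finset (Finset (Fin n))} (x : Pairs 𝒮) :
    Module.Dual ℝ (Fin n → ℝ) :=
  LinearMap.proj x.2.1 - (x.1.1.card : ℝ)⁻¹ • ∑ j ∈ x.1.1, LinearMap.proj j

lemma relativeUtility_apply {𝒮 : Finset (Finset (Fin n))} (x : Pairs 𝒮) (w : Fin n → ℝ) :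
    relativeUtility x w = w x.2 - (x.1.1.card : ℝ)⁻¹ * ∑ j ∈ x.1.1, w j := by
  simp [relativeUtility]

lemma relativeUtility_single {𝒮 : Finset (Finset (Fin n))} (x : Pairs 𝒮) (k : Fin n) :
    relativeUtility x (Pi.single k 1) =
      (if k = x.2 then 1 else 0) - if k ∈ x.1.1 then (x.1.1.card : ℝ)⁻¹ else 0 := by
  rw [relativeUtility_apply]
  simp [Pi.single_apply, eq_comm]

/-- When `|S| ≥ 2`, the coefficient on a unit vector is positive only at the chosen product and
negative exactly on the rest of `S`, so the functional determines the pair. For singletons the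
functional is zero. -/
lemma relativeUtility_injOn {𝒮 : Finset (Finset (Fin n))} {x y : Pairs 𝒮}
    (hx : 2 ≤ x.1.1.card) (h : relativeUtility x = relativeUtility y) : x = y := by
  obtain ⟨⟨S, hS⟩, i, hi⟩ := x
  obtain ⟨⟨T, hT⟩, j, hj⟩ := y
  simp only at hx hi hj
  have hk : ∀ k : Fin n, ((if k = i then 1 else 0) - if k ∈ S then (S.card : ℝ)⁻¹ else 0) =
      (if k = j then 1 else 0) - if k ∈ T then (T.card : ℝ)⁻¹ else 0 := fun k => by
    have := congrArg (fun f => f (Pi.single k 1)) h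
    simpa only [relativeUtility_single] using this
  have hlt : (S.card : ℝ)⁻¹ < 1 := inv_lt_one_of_one_lt₀ (by exact_mod_cast hx)
  have hTinv : (0 : ℝ) ≤ (T.card : ℝ)⁻¹ := by positivity
  have hSinv : (0 : ℝ) < (S.card : ℝ)⁻¹ := inv_pos.2 (by exact_mod_cast (by omega))
  have hki := hk i
  rw [if_pos rfl, if_pos hi] at hki
  have hij : i = j := by
    by_contra hne
    rw [if_neg hne] at hki
    split_ifs at hki <;> linarith
  subst hij
  rw [if_pos rfl, if_pos hj] at hki
  have hST : S = T := by
    ext k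
    by_cases hki' : k = i
    · subst hki'
      exact ⟨fun _ => hj, fun _ => hi⟩
    · have := hk k
      rw [if_neg hki'] at this
      constructor
      · intro hkS
        by_contra hkT
        rw [if_pos hkS, if_neg hkT] at this
        linarith
      · intro hkT
        by_contra hkS
        rw [if_neg hkS, if_pos hkT] at this
        linarith
  subst hST
  rfl

open Filter Topology in
/-- There is a choice probability collection that is affine in assortment levels and product
utilities, with positive entries that are pairwise distinct outside the singletons. -/
lemma exists_generic (𝒮 : Finset (Finset (Fin n))) (h𝒮 : ∀ S ∈ 𝒮, S.Nonempty) :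
    ∃ (p : Data 𝒮) (lam : 𝒮 → ℝ) (ν : Fin n → ℝ), p ∈ simplexes 𝒮 ∧ (∀ x, 0 < p x) ∧
      (∀ x : Pairs 𝒮, lam x.1 - ν x.2 = 1 - p x) ∧
      ∀ x y : Pairs 𝒮, x ≠ y → 2 ≤ x.1.1.card → p x ≠ p y := by
  classical
  obtain ⟨w, hw⟩ : ∃ w : Fin n → ℝ, ∀ q : {q : Pairs 𝒮 × Pairs 𝒮 // q.1 ≠ q.2 ∧
      2 ≤ q.1.1.1.card}, (relativeUtility q.1.1 - relativeUtility q.1.2) w ≠ 0 := by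
    -- Finitely many nonzero functionals have a common point where none vanishes.
    refine Module.Dual.exists_forall_ne_zero_of_forall_exists _ fun q => ?_
    by_contra! hq
    exact q.2.1 (relativeUtility_injOn q.2.2 (sub_eq_zero.1 (LinearMap.ext hq)))
  have hcard : ∀ S : 𝒮, (0 : ℝ) < (S.1.card : ℝ) := fun S => by
    exact_mod_cast (h𝒮 S S.2).card_pos
  set c : Pairs 𝒮 → ℝ := fun x => (x.1.1.card : ℝ)⁻¹ with hc
  have hpos : ∀ᶠ s : ℝ in 𝓝[≠] 0, ∀ x : Pairs 𝒮, 0 < c x + s * relativeUtility x w := by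
    refine eventually_all.2 fun x => Filter.Eventually.filter_mono nhdsWithin_le_nhds ?_
    have hcont : Continuous fun s : ℝ => c x + s * relativeUtility x w := by fun_prop
    refine hcont.continuousAt.eventually_const_lt ?_
    simpa [hc] using (h𝒮 _ x.1.2).card_pos
  have hsep : ∀ᶠ s : ℝ in 𝓝[≠] 0, ∀ x y : Pairs 𝒮, x ≠ y → 2 ≤ x.1.1.card →
      c x + s * relativeUtility x w ≠ c y + s * relativeUtility y w := by
    refine eventually_all.2 fun x => eventually_all.2 fun y => ?_
    -- For equal base values any `s ≠ 0` separates, by the choice of `w`; distinct ones stay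
    -- distinct for small `s`.
    by_cases hxy : c x = c y
    · filter_upwards [self_mem_nhdsWithin] with s hs hne h2 h
      have := hw ⟨(x, y), hne, h2⟩
      rw [LinearMap.sub_apply, sub_ne_zero] at this
      rw [hxy, add_right_inj] at h
      exact this (mul_left_cancel₀ hs h)
    · refine Filter.Eventually.filter_mono nhdsWithin_le_nhds ?_
      have hcont : ∀ x : Pairs 𝒮, ContinuousAt (fun s : ℝ => c x + s * relativeUtility x w) 0 :=
        fun x => Continuous.continuousAt (by fun_prop)
      filter_upwards [((hcont x).ne_iff_eventually_ne (hcont y)).1 (by simpa using hxy)] with s hs _ _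
      exact hs
  obtain ⟨s, hs1, hs2⟩ := (hpos.and hsep).exists
  refine ⟨WithLp.toLp 2 fun x => c x + s * relativeUtility x w,
    fun S => 1 - (S.1.card : ℝ)⁻¹ + s * ((S.1.card : ℝ)⁻¹ * ∑ j ∈ S.1, w j), fun i => s * w i,
    ⟨fun x => (hs1 x).le, fun S => ?_⟩, hs1, fun x => ?_, hs2⟩
  · simp only [hc, relativeUtility_apply, Finset.sum_add_distrib, ← Finset.mul_sum,
      Finset.sum_sub_distrib, Finset.sum_const, Finset.card_univ, Fintype.card_coe, nsmul_eq_mul]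
    rw [Finset.sum_coe_sort S.1 w, inv_mul_cancel_left₀ (hcard S).ne',
      mul_inv_cancel₀ (hcard S).ne', sub_self, mul_zero, add_zero]
  · simp only [hc, relativeUtility_apply]
    ring

/-! ### Sets of positive measure -/

lemma measurableSet_simplexes (𝒮 : Finset (Finset (Fin n))) : MeasurableSet (simplexes 𝒮) := by
  have h1 : IsClosed {p : Data 𝒮 | ∀ x, 0 ≤ p x} := by
    rw [Set.ofPred_forall]
    exact isClosed_iInter fun x => isClosed_le continuous_const (by fun_prop)
  have h2 : IsClosed {p : Data 𝒮 | ∀ S : 𝒮, ∑ i : {i : Fin n // i ∈ S.1}, p ⟨S, i⟩ = 1} := by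
    rw [Set.ofPred_forall]
    exact isClosed_iInter fun S => isClosed_eq (by fun_prop) continuous_const
  exact (h1.inter h2).measurableSet

lemma sum_barycenter {𝒮 : Finset (Finset (Fin n))} (h𝒮 : ∀ S ∈ 𝒮, S.Nonempty) (S : 𝒮) :
    ∑ i : {i : Fin n // i ∈ S.1}, barycenter 𝒮 ⟨S, i⟩ = 1 := by
  have : (S.1.card : ℝ) ≠ 0 := by exact_mod_cast (h𝒮 S S.2).card_pos.ne'
  simp [barycenter, this]

/-- A set that contains the choice probability collections near one with positive entries has
positive measure. -/
lemma lebesgue_pos_of_ball {𝒮 : Finset (Finset (Fin n))} (h𝒮 : ∀ S ∈ 𝒮, S.Nonempty)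
    {p : Data 𝒮} (hp : p ∈ simplexes 𝒮) (hpos : ∀ x, 0 < p x) {r : ℝ} (hr : 0 < r)
    {A : Set (Data 𝒮)} (hA : ∀ q ∈ simplexes 𝒮, (∀ x, 0 < q x) → dist q p < r → q ∈ A) :
    0 < lebesgue 𝒮 A := by
  set f : directions 𝒮 → Data 𝒮 := fun v => barycenter 𝒮 + (v : Data 𝒮) with hf
  have hfc : Continuous f := by fun_prop
  have hU : IsOpen ({q : Data 𝒮 | ∀ x, 0 < q x} ∩ Metric.ball p r) := by
    refine IsOpen.inter ?_ Metric.isOpen_ball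
    rw [Set.ofPred_forall]
    exact isOpen_iInter_of_finite fun x => isOpen_lt continuous_const (by fun_prop)
  set U := {q : Data 𝒮 | ∀ x, 0 < q x} ∩ Metric.ball p r with hUdef
  have hmem : ∀ v, f v ∈ U → f v ∈ simplexes 𝒮 := fun v hv =>
    ⟨fun x => (hv.1 x).le, fun S => by
      simp only [hf, PiLp.add_apply, Finset.sum_add_distrib, sum_barycenter h𝒮 S, v.2 S,
        add_zero]⟩
  have hsub : U ∩ simplexes 𝒮 ⊆ A := fun q hq => hA q hq.2 hq.1.1 hq.1.2
  have hv : p - barycenter 𝒮 ∈ directions 𝒮 := fun S => by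
    simp only [PiLp.sub_apply, Finset.sum_sub_distrib, sum_barycenter h𝒮 S, hp.2 S, sub_self]
  refine lt_of_lt_of_le ?_ (measure_mono hsub)
  have hms := hU.measurableSet.inter (measurableSet_simplexes 𝒮)
  rw [lebesgue, Measure.restrict_apply hms, Set.inter_assoc, Set.inter_self,
    Measure.map_apply hfc.measurable hms]
  have hpre : f ⁻¹' (U ∩ simplexes 𝒮) = f ⁻¹' U :=
    Set.Subset.antisymm (fun v hv => hv.1) fun v hv => ⟨hv, hmem v hv⟩
  rw [hpre]
  -- The preimage is open and contains the direction `p - barycenter 𝒮`; Haar measure charges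
  -- nonempty open sets.
  refine (hU.preimage hfc).measure_pos _ ⟨⟨_, hv⟩, ?_⟩
  change barycenter 𝒮 + (p - barycenter 𝒮) ∈ U
  rw [add_sub_cancel]
  exact ⟨hpos, Metric.mem_ball_self hr⟩

/-! ### A neighbourhood of representable collections -/

/-- Singleton entries may coincide, but they agree in all collections and so never need to be moved.
-/
lemma apply_eq_one_of_card_lt_two {𝒮 : Finset (Finset (Fin n))} {p : Data 𝒮}
    (hp : p ∈ simplexes 𝒮) {x : Pairs 𝒮} (hx : ¬ 2 ≤ x.1.1.card) : p x = 1 := by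
  obtain ⟨S, i⟩ := x
  have : Subsingleton {i : Fin n // i ∈ S.1} := by
    rw [← Fintype.card_le_one_iff_subsingleton, Fintype.card_coe]
    exact Nat.lt_succ_iff.1 (not_le.1 hx)
  rw [← hp.2 S, Fintype.sum_subsingleton _ i]

open Filter Topology in
/-- There are fixed thresholds that, for every collection near some collection with positive
entries, are turned into its complementary choice probabilities by an increasing map of the
line. -/
lemma exists_thresholds (𝒮 : Finset (Finset (Fin n))) (h𝒮 : ∀ S ∈ 𝒮, S.Nonempty) :
    ∃ (p : Data 𝒮) (lam : 𝒮 → ℝ) (ν : Fin n → ℝ) (r : ℝ), p ∈ simplexes 𝒮 ∧ (∀ x, 0 < p x) ∧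
      0 < r ∧ ∀ q ∈ simplexes 𝒮, dist q p < r →
        ∃ ψ : ℝ ≃o ℝ, (∃ K, LipschitzWith K ψ) ∧ ∀ x, ψ (lam x.1 - ν x.2) = 1 - q x := by
  classical
  obtain ⟨p, lam, ν, hp, hpos, hlam, hgen⟩ := exists_generic 𝒮 h𝒮
  obtain ⟨δ, hsep, hδ⟩ : ∃ δ : ℝ, (∀ x y : Pairs 𝒮, x ≠ y → 2 ≤ y.1.1.card →
      δ ≤ |p x - p y|) ∧ 0 < δ := by
    have h : ∀ᶠ δ : ℝ in 𝓝[>] 0, ∀ x y : Pairs 𝒮, x ≠ y → 2 ≤ y.1.1.card →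
        δ ≤ |p x - p y| := by
      refine eventually_all.2 fun x => eventually_all.2 fun y => ?_
      by_cases hxy : x ≠ y ∧ 2 ≤ y.1.1.card
      · have : 0 < |p x - p y| := abs_pos.2 (sub_ne_zero.2 (hgen y x hxy.1.symm hxy.2).symm)
        filter_upwards [nhdsWithin_le_nhds (Iic_mem_nhds this)] with δ hδ _ _
        exact hδ
      · exact Eventually.of_forall fun δ h1 h2 => absurd ⟨h1, h2⟩ hxy
    exact (h.and self_mem_nhdsWithin).exists
  have hcont : Continuous fun q : Data 𝒮 => ∑ x, |q x - p x| := by fun_prop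
  have hnear : ∀ᶠ q in 𝓝 p, ∑ x, |q x - p x| < δ / 2 := by
    refine hcont.continuousAt.eventually_lt_const ?_
    simpa using hδ
  obtain ⟨r, hr, hball⟩ := Metric.eventually_nhds_iff.1 hnear
  refine ⟨p, lam, ν, r, hp, hpos, hr, fun q hq hqp => ?_⟩
  have hsep' : ∀ x y : Pairs 𝒮, x ≠ y → q y - p y = 0 ∨ δ ≤ |1 - p x - (1 - p y)| := by
    intro x y hxy
    by_cases hy : 2 ≤ y.1.1.card
    · right
      rw [sub_sub_sub_cancel_left, abs_sub_comm]
      exact hsep x y hxy hy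
    · left
      rw [apply_eq_one_of_card_lt_two hq hy, apply_eq_one_of_card_lt_two hp hy, sub_self]
  obtain ⟨ψ, hψ, hval⟩ := exists_orderIso_apply_eq_sub (fun x => 1 - p x) (fun x => q x - p x) hδ
    hsep' (hball hqp).le
  refine ⟨ψ, hψ, fun x => ?_⟩
  rw [hlam, hval]
  ring

lemma orderConditions_of_orderIso {𝒮 : Finset (Finset (Fin n))} {q : Data 𝒮} {lam : 𝒮 → ℝ}
    {ν : Fin n → ℝ} (ψ : ℝ ≃o ℝ) (h : ∀ x : Pairs 𝒮, ψ (lam x.1 - ν x.2) = 1 - q x)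
    (R : Fin n → Fin n → Prop) : OrderConditions R q lam ν := by
  refine fun x y _ => ⟨fun hxy => ?_, fun hxy _ => ?_⟩
  · rw [gt_iff_lt, ← ψ.lt_iff_lt, h, h]
    linarith
  · rw [← ψ.injective.eq_iff, h, h, hxy]

lemma apply_le_one {𝒮 : Finset (Finset (Fin n))} {p : Data 𝒮} (hp : p ∈ simplexes 𝒮)
    (x : Pairs 𝒮) : p x ≤ 1 := by
  rw [← hp.2 x.1]
  exact Finset.single_le_sum (f := fun i => p ⟨x.1, i⟩) (fun _ _ => hp.1 _) (Finset.mem_univ x.2)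

lemma yields_of_orderIso {𝒮 : Finset (Finset (Fin n))} (h𝒮 : ∀ S ∈ 𝒮, S.Nonempty) {q : Data 𝒮}
    (hq : q ∈ simplexes 𝒮) (hpos : ∀ x, 0 < q x) {lam : 𝒮 → ℝ} {ν : Fin n → ℝ} (ψ : ℝ ≃o ℝ)
    (hψ : ∃ K, LipschitzWith K ψ) (h : ∀ x : Pairs 𝒮, ψ (lam x.1 - ν x.2) = 1 - q x) :
    Yields (fun _ => quantileLaw ψ) ν q := by
  obtain ⟨K, hK⟩ := hψ
  refine yields_of_thresholds h𝒮 (fun _ => isMarginal_quantileLaw ψ hK) ν lam hq hpos fun x => ?_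
  rw [quantileLaw_real_Ioi, h, sub_sub_cancel] <;> rw [h]
  · linarith [apply_le_one hq x]
  · linarith [hq.1 x]

end ChoiceModel

theorem theorem6 (n : ℕ) (𝒮 : Finset (Finset (Fin n))) (h𝒮 : ∀ S ∈ 𝒮, S.Nonempty)
    (𝒢 : Finpartition (Finset.univ : Finset (Fin n))) :
    (ChoiceModel.lebesgue 𝒮 (ChoiceModel.groupedSet 𝒢 𝒮) ≥
        ChoiceModel.lebesgue 𝒮 (ChoiceModel.apuSet 𝒮) ∧
      ChoiceModel.lebesgue 𝒮 (ChoiceModel.apuSet 𝒮) > 0) ∧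
    (ChoiceModel.lebesgue 𝒮 (ChoiceModel.groupedRepresentable 𝒢 𝒮) ≥
        ChoiceModel.lebesgue 𝒮 (ChoiceModel.apuRepresentable 𝒮) ∧
      ChoiceModel.lebesgue 𝒮 (ChoiceModel.apuRepresentable 𝒮) > 0) := by
  obtain ⟨p, lam, ν, r, hp, hpos, hr, h⟩ := ChoiceModel.exists_thresholds 𝒮 h𝒮
  refine ⟨⟨measure_mono ?_, ?_⟩, measure_mono ?_, ?_⟩
  · rintro q ⟨hq, lam, ν, hc⟩
    exact ⟨hq, lam, ν, fun x y _ => hc x y trivial⟩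
  · refine ChoiceModel.lebesgue_pos_of_ball h𝒮 hp hpos hr fun q hq _ hqp => ?_
    obtain ⟨ψ, -, hval⟩ := h q hq hqp
    exact ⟨hq, lam, ν, ChoiceModel.orderConditions_of_orderIso ψ hval _⟩
  · rintro q ⟨hq, F, ν, hF, hy⟩
    exact ⟨hq, fun _ => F, ν, fun _ => hF, fun _ _ _ => rfl, hy⟩
  · refine ChoiceModel.lebesgue_pos_of_ball h𝒮 hp hpos hr fun q hq hqpos hqp => ?_
    obtain ⟨ψ, hψ, hval⟩ := h q hq hqp
    obtain ⟨K, hK⟩ := hψ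
    exact ⟨hq, ChoiceModel.quantileLaw ψ, ν, ChoiceModel.isMarginal_quantileLaw ψ hK,
      ChoiceModel.yields_of_orderIso h𝒮 hq hqpos ψ ⟨K, hK⟩ hval⟩
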